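/- A variety $\mathcal C$ is the category of all algebras (possibly empty) of a given finitary signature that satisfy a given set of identities, with homomorphisms as morphisms. It has a diagonalising term if, for some $k\ge 1$, there are a $(k+2)$-ary term $t$ and constants (closed terms) $e_1,\dots,e_k,e_1',\dots,e_k'$ such that the identities $$t(x,y,e_1,\dots,e_k)=x,\qquad t(x,y,e_1',\dots,e_k')=y$$ hold in $\mathcal C$. A relation on an algebra $M$ is homomorphic if it is a subalgebra of $M\times M$, and a congruence is a homomorphic equivalence relation. For relations $R_A$ on $A$ and $R_B$ on $B$, the relation $R_A\times R_B$ on $A\times B$ relates $(a,b)$ to $(c,d)$ if and only if $a\,R_A\,c$ and $b\,R_B\,d$. For a morphism $h\colon X\times Y\to Z$ consider the commutative diagrams $$\begin{array}{ccccc} X & \xleftarrow{\ \pi_X\ } & X\times Y & \xrightarrow{\ \pi_Y\ } & Y\\ {\scriptstyle f}\downarrow & & {\scriptstyle h}\downarrow & & \downarrow{\scriptstyle g}\\ A' & \xleftarrow{\ p_1\ } & Z & \xrightarrow{\ p_2\ } & B'\end{array}\qquad(*)$$ **Proposition.** Let $\mathcal C$ be a variety with a diagonalising term. Then the following hold. 1.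 $\mathcal C$ has co-disjoint products: all product projections are epimorphisms, and for all $X,Y$ in $\mathcal C$ the square formed by the projections $X\leftarrow X\times Y\to Y$ and the morphisms $X\to 1\leftarrow Y$ to the terminal object is a pushout. 2. $\mathcal C$ is left coextensive: for all $X,Y,Z$, all $h\colon X\times Y\to Z$ and every commutative diagram $(*)$ whose bottom row is a product diagram, both squares of $(*)$ are pushouts. 3. For all $A,B$ in $\mathcal C$, any reflexive homomorphic relation $R$ on $A\times B$ is of the form $R_A\times R_B$ for some reflexive homomorphic relations $R_A$ on $A$ and $R_B$ on $B$. 4. For all $A,B$ in $\mathcal C$, any congruence $E$ on $A\times B$ is of the form $E_A\times E_B$ for some congruences $E_A$ on $A$ and $E_B$ on $B$. 5. $\mathcal C$ satisfies the coextensivity condition for any surjective homomorphism $q\colon A\times B\to Z$: in every commutative diagram $(*)$ with $X=A$, $Y=B$ and $h=q$, the bottom row is a product diagram if and only if both squares are pushouts. -/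

import Mathlib

open CategoryTheory CategoryTheory.Limits FirstOrder

universe u v w

/-! Varieties of universal algebras. A signature is a first-order language without relation
symbols (`L.IsAlgebraic`), an algebra is an `L`-structure (possibly empty), and a variety is the
class of all algebras that satisfy a given set of identities between terms. -/

section Algebras

variable (L : FirstOrder.Language.{u, v})

/-- The componentwise algebra structure on a product. -/
instance prodStructure (M N : Type*) [L.Structure M] [L.Structure N] : L.Structure (M × N) where
  funMap f x :=
    (FirstOrder.Language.Structure.funMap f fun i => (x i).1,
      FirstOrder.Language.Structure.funMap f fun i => (x i).2)
  RelMap r x :=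
    FirstOrder.Language.Structure.RelMap r (fun i => (x i).1) ∧
      FirstOrder.Language.Structure.RelMap r (fun i => (x i).2)

/-- The algebra structure on a one-point set. -/
instance punitStructure : L.Structure PUnit.{w + 1} where
  funMap _ _ := PUnit.unit
  RelMap _ _ := True

end Algebras

/-- A set of identities in countably many variables; the pair `(s, s')` stands for `s = s'`. -/
abbrev Identities (L : FirstOrder.Language.{u, v}) : Type u := Set (L.Term ℕ × L.Term ℕ)

/-- An algebra of the variety defined by the identities `E`. -/
structure VarietyAlg (L : FirstOrder.Language.{u, v}) (E : Identities L) where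
  carrier : Type w
  [str : L.Structure carrier]
  sat : ∀ s ∈ E, ∀ x : ℕ → carrier, s.1.realize x = s.2.realize x

namespace VarietyAlg

variable {L : FirstOrder.Language.{u, v}} {E : Identities L}

instance : CoeSort (VarietyAlg.{u, v, w} L E) (Type w) := ⟨carrier⟩

instance (A : VarietyAlg.{u, v, w} L E) : L.Structure A := A.str

/-- The category of algebras of the variety and their homomorphisms. -/
instance : Category (VarietyAlg.{u, v, w} L E) where
  Hom A B := A →[L] B
  id A := FirstOrder.Language.Hom.id L A
  comp f g := g.comp f
  id_comp _ := FirstOrder.Language.Hom.comp_id _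
  comp_id _ := FirstOrder.Language.Hom.id_comp _
  assoc _ _ _ := rfl

instance : ConcreteCategory (VarietyAlg.{u, v, w} L E) (fun A B => A →[L] B) where
  hom f := f
  ofHom f := f

theorem realize_prod {M N α : Type*} [L.Structure M] [L.Structure N] (s : L.Term α)
    (x : α → M × N) :
    s.realize x = (s.realize fun i => (x i).1, s.realize fun i => (x i).2) := by
  induction s with
  | var a => rfl
  | func f ts ih =>
    simp only [FirstOrder.Language.Term.realize_func, ih]
    rfl

/-- The product algebra `A × B`, with componentwise operations. -/
def prod (A B : VarietyAlg.{u, v, w} L E) : VarietyAlg.{u, v, w} L E where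
  carrier := A × B
  sat s hs x := by
    rw [realize_prod, realize_prod]
    exact Prod.ext (A.sat s hs _) (B.sat s hs _)

/-- The one-point algebra. -/
def point (L : FirstOrder.Language.{u, v}) (E : Identities L) : VarietyAlg.{u, v, w} L E where
  carrier := PUnit.{w + 1}
  sat _ _ _ := rfl

/-- The first projection of the product algebra. -/
def prodFst (A B : VarietyAlg.{u, v, w} L E) : prod A B ⟶ A :=
  ({ toFun := fun x : A × B => x.1
     map_fun' := fun _ _ => rfl
     map_rel' := fun _ _ h => h.1 } : A × B →[L] A)

/-- The second projection of the product algebra. -/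
def prodSnd (A B : VarietyAlg.{u, v, w} L E) : prod A B ⟶ B :=
  ({ toFun := fun x : A × B => x.2
     map_fun' := fun _ _ => rfl
     map_rel' := fun _ _ h => h.2 } : A × B →[L] B)

/-- The homomorphism into a product algebra with given components. -/
def pairing {D A B : VarietyAlg.{u, v, w} L E} (f : D ⟶ A) (g : D ⟶ B) : D ⟶ prod A B :=
  ({ toFun := fun x => (f x, g x)
     map_fun' := fun F x => Prod.ext
      (FirstOrder.Language.Hom.map_fun (L := L) (M := D) (N := A) f F x)
      (FirstOrder.Language.Hom.map_fun (L := L) (M := D) (N := B) g F x)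
     map_rel' := fun r x h =>
      ⟨FirstOrder.Language.Hom.map_rel (L := L) (M := D) (N := A) f r x h,
        FirstOrder.Language.Hom.map_rel (L := L) (M := D) (N := B) g r x h⟩ } : D →[L] A × B)

/-- The product algebra is the categorical product. -/
def prodIsLimit (A B : VarietyAlg.{u, v, w} L E) :
    IsLimit (BinaryFan.mk (prodFst A B) (prodSnd A B)) :=
  BinaryFan.IsLimit.mk _ (fun f g => pairing f g) (fun _ _ => rfl) (fun _ _ => rfl)
    (fun f g m h₁ h₂ => by subst h₁ h₂; rfl)

/-- The one-point algebra is a terminal object. -/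
def pointIsTerminal (L : FirstOrder.Language.{u, v}) (E : Identities L) :
    IsTerminal (point.{u, v, w} L E) :=
  IsTerminal.ofUniqueHom
    (fun A => ({ toFun := fun _ => PUnit.unit
                 map_fun' := fun _ _ => rfl
                 map_rel' := fun _ _ _ => trivial } : A →[L] PUnit.{w + 1}))
    (fun _ _ => rfl)

instance : HasFiniteProducts (VarietyAlg.{u, v, w} L E) := by
  have : HasTerminal (VarietyAlg.{u, v, w} L E) := (pointIsTerminal L E).hasTerminal
  have : ∀ {A B : VarietyAlg.{u, v, w} L E}, HasLimit (pair A B) :=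
    fun {A B} => ⟨⟨⟨_, prodIsLimit A B⟩⟩⟩
  have := hasBinaryProducts_of_hasLimit_pair (VarietyAlg.{u, v, w} L E)
  exact hasFiniteProducts_of_has_binary_and_terminal

end VarietyAlg

/-- The variety has a diagonalising term: for some `k ≥ 1`, a `(k+2)`-ary term `t` and constants
(closed terms) `e 1, …, e k, e' 1, …, e' k` such that the identities
`t(x, y, e 1, …, e k) = x` and `t(x, y, e' 1, …, e' k) = y` hold in all algebras of the variety. -/
def HasDiagonalisingTerm (L : FirstOrder.Language.{u, v}) (E : Identities L) : Prop :=
  ∃ k : ℕ, 1 ≤ k ∧ ∃ (t : L.Term (Fin (k + 2))) (e e' : Fin k → L.Term Empty),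
    ∀ (A : VarietyAlg.{u, v, w} L E) (x y : A),
      t.realize (Matrix.vecCons x
        (Matrix.vecCons y fun i => (e i).realize (Empty.elim : Empty → A))) = x ∧
      t.realize (Matrix.vecCons x
        (Matrix.vecCons y fun i => (e' i).realize (Empty.elim : Empty → A))) = y

section Coextensivity

variable (C : Type*) [Category C] [HasFiniteProducts C]

/-- All product projections are epimorphisms, and the square formed by the two projections of
`X ⨯ Y` and the morphisms to the terminal object is always a pushout. -/
def HasCodisjointProducts : Prop :=
  (∀ X Y : C, Epi (prod.fst : X ⨯ Y ⟶ X) ∧ Epi (prod.snd : X ⨯ Y ⟶ Y)) ∧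
    ∀ X Y : C, IsPushout (prod.fst : X ⨯ Y ⟶ X) prod.snd (terminal.from X) (terminal.from Y)

/-- In every commutative diagram
```
  X ←── X ⨯ Y ──→ Y
  |f      |h      |g
  A ←──── Z ────→ B
```
whose bottom row `(p, q)` is a product diagram, both squares are pushouts. -/
def LeftCoextensive : Prop :=
  ∀ ⦃X Y Z A B : C⦄ (h : X ⨯ Y ⟶ Z) (f : X ⟶ A) (g : Y ⟶ B) (p : Z ⟶ A) (q : Z ⟶ B),
    prod.fst ≫ f = h ≫ p → prod.snd ≫ g = h ≫ q →
    Nonempty (IsLimit (BinaryFan.mk p q)) →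
      IsPushout prod.fst h f p ∧ IsPushout prod.snd h g q

variable {C}

/-- The coextensivity condition for a single morphism `h : X ⨯ Y ⟶ Z`: in every commutative diagram
```
  X ←── X ⨯ Y ──→ Y
  |f      |h      |g
  A ←──── Z ────→ B
```
the bottom row `(p, q)` is a product diagram if and only if both squares are pushouts. -/
def CoextensivityConditionFor {X Y Z : C} (h : X ⨯ Y ⟶ Z) : Prop :=
  ∀ ⦃A B : C⦄ (f : X ⟶ A) (g : Y ⟶ B) (p : Z ⟶ A) (q : Z ⟶ B),
    prod.fst ≫ f = h ≫ p → prod.snd ≫ g = h ≫ q →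
      (Nonempty (IsLimit (BinaryFan.mk p q)) ↔
        IsPushout prod.fst h f p ∧ IsPushout prod.snd h g q)

end Coextensivity

section Relations

/-- A relation on an algebra is homomorphic if it is compatible with all operations, that is, if it
is a subalgebra of `M × M`. -/
def IsHomomorphicRel (L : FirstOrder.Language.{u, v}) {M : Type*} [L.Structure M]
    (R : M → M → Prop) : Prop :=
  ∀ ⦃n : ℕ⦄ (f : L.Functions n) (x y : Fin n → M), (∀ i, R (x i) (y i)) →
    R (FirstOrder.Language.Structure.funMap f x) (FirstOrder.Language.Structure.funMap f y)

/-- A reflexive homomorphic relation on an algebra. -/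
def IsReflexiveHomomorphicRel (L : FirstOrder.Language.{u, v}) {M : Type*} [L.Structure M]
    (R : M → M → Prop) : Prop :=
  (∀ x, R x x) ∧ IsHomomorphicRel L R

/-- A congruence: a homomorphic equivalence relation. -/
def IsCongruence (L : FirstOrder.Language.{u, v}) {M : Type*} [L.Structure M]
    (R : M → M → Prop) : Prop :=
  Equivalence R ∧ IsHomomorphicRel L R

/-- The product relation: `(a, b)` and `(c, d)` are related if and only if `a, c` are related by
`R` and `b, d` are related by `S`. -/
def prodRel {M N : Type*} (R : M → M → Prop) (S : N → N → Prop) : M × N → M × N → Prop :=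
  fun x y => R x.1 y.1 ∧ S x.2 y.2

end Relations

/-! In a product `A × B` the elements `c i = (e i, e' i)` turn the diagonalising term into a mixing
operation: `t(x, x', c) = (x.1, x'.2)`. Everything beyond nonemptiness follows from this.

A reflexive homomorphic relation contains each `(c i, c i)`, so it is closed under mixing and splits
as a product (`reflexiveHomomorphicRel_recombine`, `eq_prodRel`).

For left coextensivity, the mixing parameters of `Z` are the images `h (c i)`. A cocone on the left
square sends them to the constants `e i`, so there `t` returns its first argument and the cocone
cannot see the second coordinate (`leftCoextensive`).

A surjection from a product has a kernel that splits, so its target is a product of quotients. Its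
squares are pushouts by left coextensivity, and uniqueness of pushouts gives the converse direction.
-/

theorem isPushout_of_exists_desc {C : Type*} [Category C] {P X Y Z : C} {f : P ⟶ X} {g : P ⟶ Y}
    {i : X ⟶ Z} {j : Y ⟶ Z} (comm : f ≫ i = g ≫ j) (hj : Epi j)
    (desc : ∀ {W : C} (a : X ⟶ W) (b : Y ⟶ W), f ≫ a = g ≫ b → ∃ l, i ≫ l = a ∧ j ≫ l = b) :
    IsPushout f g i j :=
  ⟨⟨comm⟩, ⟨PushoutCocone.isColimitAux' _ fun s =>
    have hl := desc s.inl s.inr s.condition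
    ⟨hl.choose, hl.choose_spec.1, hl.choose_spec.2, fun {_} _ hm =>
      (cancel_epi j).1 (hm.trans hl.choose_spec.2.symm)⟩⟩⟩

namespace VarietyAlg

variable {L : FirstOrder.Language.{u, v}} {E : Identities L}

/-! ### Terms under homomorphisms and relations -/

theorem hom_realize {α : Type*} {A B : VarietyAlg.{u, v, w} L E} (f : A ⟶ B) (s : L.Term α)
    (x : α → A) : f (s.realize x) = s.realize fun i => f (x i) :=
  (FirstOrder.Language.HomClass.realize_term (L := L) (M := A) (N := B) (F := A →[L] B) f).symm

theorem hom_realize_closed {A B : VarietyAlg.{u, v, w} L E} (f : A ⟶ B) (s : L.Term Empty) :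
    f (s.realize (Empty.elim : Empty → A)) = s.realize (Empty.elim : Empty → B) := by
  rw [hom_realize]
  congr 1
  exact funext fun i => i.elim

theorem hom_realize_vecCons {k : ℕ} {A B : VarietyAlg.{u, v, w} L E} (f : A ⟶ B)
    (t : L.Term (Fin (k + 2))) (x y : A) (c : Fin k → A) :
    f (t.realize (Matrix.vecCons x (Matrix.vecCons y c))) =
      t.realize (Matrix.vecCons (f x) (Matrix.vecCons (f y) fun i => f (c i))) := by
  rw [hom_realize]
  congr 1
  funext i
  refine Fin.cases rfl (fun i => ?_) i
  exact Fin.cases rfl (fun _ => rfl) i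

theorem _root_.IsHomomorphicRel.realize {M α : Type*} [L.Structure M] {R : M → M → Prop}
    (hR : IsHomomorphicRel L R) (s : L.Term α) {x y : α → M} (h : ∀ i, R (x i) (y i)) :
    R (s.realize x) (s.realize y) := by
  induction s with
  | var a => exact h a
  | func f ts ih => exact hR f _ _ ih

/-- The condition `k ≥ 1` supplies a constant. Without one, an empty factor would spoil surjectivity
of projections. -/
theorem nonempty_of_hasDiagonalisingTerm (hdiag : HasDiagonalisingTerm.{u, v, w} L E)
    (A : VarietyAlg.{u, v, w} L E) : Nonempty A := by
  obtain ⟨k, hk, _, e, _⟩ := hdiag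
  exact ⟨(e ⟨0, hk⟩).realize (Empty.elim : Empty → A)⟩

/-! ### Surjections and products -/

/-- Homomorphisms descend along surjective homomorphisms. -/
theorem exists_desc [L.IsAlgebraic] {A B W : VarietyAlg.{u, v, w} L E} (e : A ⟶ B)
    (he : Function.Surjective e) (v : A ⟶ W) (h : ∀ a a', e a = e a' → v a = v a') :
    ∃ l : B ⟶ W, e ≫ l = v := by
  have hs (b : B) : e (Function.surjInv he b) = b := Function.surjInv_eq he b
  refine ⟨({ toFun := fun b => v (Function.surjInv he b)
             map_fun' := fun F x => ?_
             map_rel' := fun r => isEmptyElim r } : B →[L] W), ?_⟩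
  -- The chosen section need not be a homomorphism, but both ways of applying `F` have the same
  -- image under `e`, hence under `v`.
  · refine Eq.trans (h _ (FirstOrder.Language.Structure.funMap F
      fun i => Function.surjInv he (x i)) ?_)
      (FirstOrder.Language.Hom.map_fun (L := L) (M := A) (N := W) v F _)
    rw [hs]
    refine Eq.trans ?_ (FirstOrder.Language.Hom.map_fun (L := L) (M := A) (N := B) e F _).symm
    congr 1
    exact funext fun i => (hs _).symm
  · exact ConcreteCategory.hom_ext _ _ fun a => h _ _ (hs (e a))

theorem epi_of_surjective {A B : VarietyAlg.{u, v, w} L E} (e : A ⟶ B)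
    (he : Function.Surjective e) : Epi e where
  left_cancellation f g h := ConcreteCategory.hom_ext _ _ fun b => by
    obtain ⟨a, rfl⟩ := he b
    exact ConcreteCategory.congr_hom h a

/-- A span is a product diagram exactly when it is one on underlying sets. -/
theorem nonempty_isLimit_iff_bijective [L.IsAlgebraic] {Z A B : VarietyAlg.{u, v, w} L E}
    (p : Z ⟶ A) (q : Z ⟶ B) :
    Nonempty (IsLimit (BinaryFan.mk p q)) ↔ Function.Bijective fun z : Z => (p z, q z) := by
  constructor
  · rintro ⟨hl⟩
    obtain ⟨r, hr₁, hr₂⟩ := BinaryFan.IsLimit.lift' hl (prodFst A B) (prodSnd A B)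
    have h₁ : pairing p q ≫ r = 𝟙 Z := by
      refine BinaryFan.IsLimit.hom_ext hl ?_ ?_
      · rw [Category.assoc, hr₁, Category.id_comp]; rfl
      · rw [Category.assoc, hr₂, Category.id_comp]; rfl
    have h₂ : r ≫ pairing p q = 𝟙 (prod A B) := by
      refine BinaryFan.IsLimit.hom_ext (prodIsLimit A B) ?_ ?_
      · exact hr₁
      · exact hr₂
    exact Function.bijective_iff_has_inverse.2
      ⟨r, ConcreteCategory.congr_hom h₁, ConcreteCategory.congr_hom h₂⟩
  · intro hb
    -- Descending the identity along the bijection gives its inverse homomorphism.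
    obtain ⟨r, hr⟩ := exists_desc (pairing p q) hb.2 (𝟙 Z) fun a a' h => hb.1 h
    have := epi_of_surjective (pairing p q) hb.2
    have hr' : r ≫ pairing p q = 𝟙 (prod A B) := by
      rw [← cancel_epi (pairing p q), ← Category.assoc, hr, Category.id_comp, Category.comp_id]
    let i : Z ≅ prod A B := ⟨pairing p q, r, hr, hr'⟩
    exact ⟨(prodIsLimit A B).ofIsoLimit (BinaryFan.ext i.symm
      (by rw [← cancel_epi i.hom]; exact (Iso.hom_inv_id_assoc i p).symm)
      (by rw [← cancel_epi i.hom]; exact (Iso.hom_inv_id_assoc i q).symm))⟩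

theorem bijective_prod [L.IsAlgebraic] (X Y : VarietyAlg.{u, v, w} L E) :
    Function.Bijective fun z : (X ⨯ Y : VarietyAlg.{u, v, w} L E) =>
      ((prod.fst : X ⨯ Y ⟶ X) z, (prod.snd : X ⨯ Y ⟶ Y) z) :=
  (nonempty_isLimit_iff_bijective _ _).1 ⟨prodIsProd X Y⟩

theorem exists_prod_eq [L.IsAlgebraic] {X Y : VarietyAlg.{u, v, w} L E} (x : X) (y : Y) :
    ∃ z : (X ⨯ Y : VarietyAlg.{u, v, w} L E),
      (prod.fst : X ⨯ Y ⟶ X) z = x ∧ (prod.snd : X ⨯ Y ⟶ Y) z = y := by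
  obtain ⟨z, hz⟩ := (bijective_prod X Y).2 (x, y)
  exact ⟨z, congrArg Prod.fst hz, congrArg Prod.snd hz⟩

theorem surjective_fst [L.IsAlgebraic] (hdiag : HasDiagonalisingTerm.{u, v, w} L E)
    (X Y : VarietyAlg.{u, v, w} L E) : Function.Surjective (prod.fst : X ⨯ Y ⟶ X) := fun x => by
  obtain ⟨y⟩ := nonempty_of_hasDiagonalisingTerm hdiag Y
  obtain ⟨z, hz, -⟩ := exists_prod_eq x y
  exact ⟨z, hz⟩

theorem surjective_snd [L.IsAlgebraic] (hdiag : HasDiagonalisingTerm.{u, v, w} L E)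
    (X Y : VarietyAlg.{u, v, w} L E) : Function.Surjective (prod.snd : X ⨯ Y ⟶ Y) := fun y => by
  obtain ⟨x⟩ := nonempty_of_hasDiagonalisingTerm hdiag X
  obtain ⟨z, -, hz⟩ := exists_prod_eq x y
  exact ⟨z, hz⟩

theorem subsingleton_terminal : Subsingleton (⊤_ (VarietyAlg.{u, v, w} L E)) := by
  let i := terminalIsTerminal.uniqueUpToIso (pointIsTerminal.{u, v, w} L E)
  refine ⟨fun a b => ?_⟩
  rw [← show i.inv (i.hom a) = a from ConcreteCategory.congr_hom i.hom_inv_id a,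
    ← show i.inv (i.hom b) = b from ConcreteCategory.congr_hom i.hom_inv_id b]
  rfl

/-! ### Co-disjoint products and left coextensivity -/

theorem hasCodisjointProducts [L.IsAlgebraic] (hdiag : HasDiagonalisingTerm.{u, v, w} L E) :
    HasCodisjointProducts (VarietyAlg.{u, v, w} L E) := by
  refine ⟨fun X Y => ⟨epi_of_surjective _ (surjective_fst hdiag X Y),
    epi_of_surjective _ (surjective_snd hdiag X Y)⟩, fun X Y => ?_⟩
  have := subsingleton_terminal (L := L) (E := E)
  obtain ⟨x₀⟩ := nonempty_of_hasDiagonalisingTerm hdiag X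
  obtain ⟨y₀⟩ := nonempty_of_hasDiagonalisingTerm hdiag Y
  have hX : Function.Surjective (terminal.from X) := fun _ => ⟨x₀, Subsingleton.elim _ _⟩
  refine isPushout_of_exists_desc (Subsingleton.elim _ _)
    (epi_of_surjective _ fun _ => ⟨y₀, Subsingleton.elim _ _⟩) fun {W} a b hab => ?_
  -- Since `x` and `y` vary independently, both legs are constant with a common value.
  have hc (x : X) (y : Y) : a x = b y := by
    obtain ⟨z, rfl, rfl⟩ := exists_prod_eq x y
    exact ConcreteCategory.congr_hom hab z
  obtain ⟨l, hl⟩ := exists_desc (terminal.from X) hX a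
    fun x x' _ => (hc x y₀).trans (hc x' y₀).symm
  refine ⟨l, hl, ConcreteCategory.hom_ext _ _ fun y => ?_⟩
  rw [← hc x₀ y, ← ConcreteCategory.congr_hom hl x₀]
  exact congrArg l (Subsingleton.elim _ _)

/-- A commutative square with surjective upper and lower sides `π` and `p` is a pushout if every
cocone identifies the elements that `p` identifies. -/
theorem isPushout_of_surjective [L.IsAlgebraic] {P X Z A : VarietyAlg.{u, v, w} L E}
    {π : P ⟶ X} {h : P ⟶ Z} {f : X ⟶ A} {p : Z ⟶ A} (hπ : Function.Surjective π)
    (hp : Function.Surjective p) (comm : π ≫ f = h ≫ p)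
    (hker : ∀ {W : VarietyAlg.{u, v, w} L E} (a : X ⟶ W) (b : Z ⟶ W), π ≫ a = h ≫ b →
      ∀ z z', p z = p z' → b z = b z') :
    IsPushout π h f p := by
  have := epi_of_surjective _ hπ
  refine isPushout_of_exists_desc comm (epi_of_surjective _ hp) fun a b hab => ?_
  obtain ⟨l, hl⟩ := exists_desc p hp b (hker a b hab)
  refine ⟨l, ?_, hl⟩
  rw [← cancel_epi π, ← Category.assoc, comm, Category.assoc, hl, hab]

theorem leftCoextensive [L.IsAlgebraic] (hdiag : HasDiagonalisingTerm.{u, v, w} L E) :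
    LeftCoextensive (VarietyAlg.{u, v, w} L E) := by
  intro X Y Z A B h f g p q hf hg hpq
  have hb := (nonempty_isLimit_iff_bijective p q).1 hpq
  obtain ⟨a₀⟩ := nonempty_of_hasDiagonalisingTerm hdiag A
  obtain ⟨b₀⟩ := nonempty_of_hasDiagonalisingTerm hdiag B
  have hp : Function.Surjective p := fun a => by
    obtain ⟨z, hz⟩ := hb.2 (a, b₀)
    exact ⟨z, congrArg Prod.fst hz⟩
  have hq : Function.Surjective q := fun b => by
    obtain ⟨z, hz⟩ := hb.2 (a₀, b)
    exact ⟨z, congrArg Prod.snd hz⟩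
  have hX := surjective_fst hdiag X Y
  have hY := surjective_snd hdiag X Y
  obtain ⟨k, -, t, e, e', ht⟩ := hdiag
  -- The parameters are chosen in `X ⨯ Y`, not in `Z`, so that commutativity of a cocone determines
  -- their images.
  choose c hc₁ hc₂ using fun i => exists_prod_eq (X := X) (Y := Y)
    ((e i).realize Empty.elim) ((e' i).realize Empty.elim)
  have hpc (i : Fin k) : p (h (c i)) = (e i).realize Empty.elim :=
    (ConcreteCategory.congr_hom hf (c i)).symm.trans
      ((congrArg f (hc₁ i)).trans (hom_realize_closed f _))
  have hqc (i : Fin k) : q (h (c i)) = (e' i).realize Empty.elim :=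
    (ConcreteCategory.congr_hom hg (c i)).symm.trans
      ((congrArg g (hc₂ i)).trans (hom_realize_closed g _))
  have hp_t (z z' : Z) :
      p (t.realize (Matrix.vecCons z (Matrix.vecCons z' fun i => h (c i)))) = p z := by
    simp only [hom_realize_vecCons, hpc, (ht A _ _).1]
  have hq_t (z z' : Z) :
      q (t.realize (Matrix.vecCons z (Matrix.vecCons z' fun i => h (c i)))) = q z' := by
    simp only [hom_realize_vecCons, hqc, (ht B _ _).2]
  constructor
  · refine isPushout_of_surjective hX hp hf fun {W} a b hab z z' hz => ?_
    have hbc (i : Fin k) : b (h (c i)) = (e i).realize Empty.elim :=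
      (ConcreteCategory.congr_hom hab (c i)).symm.trans
        ((congrArg a (hc₁ i)).trans (hom_realize_closed a _))
    -- Mixing `z` with `z'` gives `z'`, as their first coordinates agree; in `W` the same term
    -- returns `b z`.
    have key : t.realize (Matrix.vecCons z (Matrix.vecCons z' fun i => h (c i))) = z' :=
      hb.1 (Prod.ext ((hp_t z z').trans hz) (hq_t z z'))
    rw [← key]
    simp only [hom_realize_vecCons, hbc, (ht W _ _).1]
  · refine isPushout_of_surjective hY hq hg fun {W} a b hab z z' hz => ?_
    have hbc (i : Fin k) : b (h (c i)) = (e' i).realize Empty.elim :=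
      (ConcreteCategory.congr_hom hab (c i)).symm.trans
        ((congrArg a (hc₂ i)).trans (hom_realize_closed a _))
    have key : t.realize (Matrix.vecCons z (Matrix.vecCons z' fun i => h (c i))) = z :=
      hb.1 (Prod.ext (hp_t z z') ((hq_t z z').trans hz.symm))
    conv_lhs => rw [← key]
    simp only [hom_realize_vecCons, hbc, (ht W _ _).2]

/-! ### Relations on products -/

/-- The components of two related pairs of a reflexive homomorphic relation can be recombined. -/
theorem reflexiveHomomorphicRel_recombine (hdiag : HasDiagonalisingTerm.{u, v, w} L E)
    {A B : VarietyAlg.{u, v, w} L E} {R : A × B → A × B → Prop}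
    (hR : IsReflexiveHomomorphicRel L R) {x y x' y' : A × B} (h : R x y) (h' : R x' y') :
    R (x.1, x'.2) (y.1, y'.2) := by
  obtain ⟨k, -, t, e, e', ht⟩ := hdiag
  let c (i : Fin k) : A × B := ((e i).realize Empty.elim, (e' i).realize Empty.elim)
  have key (x x' : A × B) :
      t.realize (Matrix.vecCons x (Matrix.vecCons x' c)) = (x.1, x'.2) := by
    refine Prod.ext ?_ ?_
    · refine (hom_realize_vecCons (prodFst A B) t x x' c).trans ?_
      exact (ht A x.1 x'.1).1
    · refine (hom_realize_vecCons (prodSnd A B) t x x' c).trans ?_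
      exact (ht B x.2 x'.2).2
  rw [← key, ← key]
  -- The same parameters occur on both sides, so reflexivity relates them.
  refine hR.2.realize t fun i => ?_
  refine Fin.cases h (fun i => ?_) i
  exact Fin.cases h' (fun i => hR.1 (c i)) i

/-- The relation on the first factor induced by a relation on a product. -/
def relFst {M N : Type*} (R : M × N → M × N → Prop) (a a' : M) : Prop :=
  ∃ b b', R (a, b) (a', b')

/-- The relation on the second factor induced by a relation on a product. -/
def relSnd {M N : Type*} (R : M × N → M × N → Prop) (b b' : N) : Prop :=
  ∃ a a', R (a, b) (a', b')

theorem isReflexiveHomomorphicRel_relFst (hdiag : HasDiagonalisingTerm.{u, v, w} L E)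
    {A B : VarietyAlg.{u, v, w} L E} {R : A × B → A × B → Prop}
    (hR : IsReflexiveHomomorphicRel L R) : IsReflexiveHomomorphicRel L (relFst R) := by
  obtain ⟨b⟩ := nonempty_of_hasDiagonalisingTerm hdiag B
  refine ⟨fun a => ⟨b, b, hR.1 _⟩, fun n F x y h => ?_⟩
  choose r s hrs using h
  exact ⟨_, _, hR.2 F _ _ hrs⟩

theorem isReflexiveHomomorphicRel_relSnd (hdiag : HasDiagonalisingTerm.{u, v, w} L E)
    {A B : VarietyAlg.{u, v, w} L E} {R : A × B → A × B → Prop}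
    (hR : IsReflexiveHomomorphicRel L R) : IsReflexiveHomomorphicRel L (relSnd R) := by
  obtain ⟨a⟩ := nonempty_of_hasDiagonalisingTerm hdiag A
  refine ⟨fun b => ⟨a, a, hR.1 _⟩, fun n F x y h => ?_⟩
  choose r s hrs using h
  exact ⟨_, _, hR.2 F _ _ hrs⟩

theorem eq_prodRel (hdiag : HasDiagonalisingTerm.{u, v, w} L E)
    {A B : VarietyAlg.{u, v, w} L E} {R : A × B → A × B → Prop}
    (hR : IsReflexiveHomomorphicRel L R) : R = prodRel (relFst R) (relSnd R) := by
  funext x y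
  refine propext ⟨fun h => ⟨⟨_, _, h⟩, ⟨_, _, h⟩⟩, ?_⟩
  rintro ⟨⟨_, _, h⟩, ⟨_, _, h'⟩⟩
  have key := reflexiveHomomorphicRel_recombine hdiag hR h h'
  exact key

theorem _root_.IsCongruence.isReflexiveHomomorphicRel {M : Type*} [L.Structure M]
    {R : M → M → Prop} (hR : IsCongruence L R) : IsReflexiveHomomorphicRel L R :=
  ⟨hR.1.refl, hR.2⟩

theorem isCongruence_relFst (hdiag : HasDiagonalisingTerm.{u, v, w} L E)
    {A B : VarietyAlg.{u, v, w} L E} {R : A × B → A × B → Prop}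
    (hR : IsCongruence L R) : IsCongruence L (relFst R) := by
  have hr := hR.isReflexiveHomomorphicRel
  have h₁ := isReflexiveHomomorphicRel_relFst hdiag hr
  refine ⟨⟨h₁.1, fun ⟨b, b', h⟩ => ⟨b', b, hR.1.symm h⟩, ?_⟩, h₁.2⟩
  rintro x y z ⟨b, b', h⟩ ⟨c, c', h'⟩
  -- The second coordinates `b'` and `c` need not match; mixing with a reflexive pair replaces all
  -- of them by `b`.
  exact ⟨b, b, hR.1.trans (reflexiveHomomorphicRel_recombine hdiag hr h (hr.1 (x, b)))
    (reflexiveHomomorphicRel_recombine hdiag hr h' (hr.1 (x, b)))⟩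

theorem isCongruence_relSnd (hdiag : HasDiagonalisingTerm.{u, v, w} L E)
    {A B : VarietyAlg.{u, v, w} L E} {R : A × B → A × B → Prop}
    (hR : IsCongruence L R) : IsCongruence L (relSnd R) := by
  have hr := hR.isReflexiveHomomorphicRel
  have h₁ := isReflexiveHomomorphicRel_relSnd hdiag hr
  refine ⟨⟨h₁.1, fun ⟨b, b', h⟩ => ⟨b', b, hR.1.symm h⟩, ?_⟩, h₁.2⟩
  rintro x y z ⟨b, b', h⟩ ⟨c, c', h'⟩
  exact ⟨b, b, hR.1.trans (reflexiveHomomorphicRel_recombine hdiag hr (hr.1 (b, x)) h)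
    (reflexiveHomomorphicRel_recombine hdiag hr (hr.1 (b, x)) h')⟩

/-! ### Quotients and coextensivity for surjections -/

/-- Every congruence is the kernel of a surjective homomorphism of the variety. -/
theorem exists_quotient [L.IsAlgebraic] (A : VarietyAlg.{u, v, w} L E) {R : A → A → Prop}
    (hR : IsCongruence L R) :
    ∃ (Q : VarietyAlg.{u, v, w} L E) (π : A ⟶ Q),
      Function.Surjective π ∧ ∀ a a', π a = π a' ↔ R a a' := by
  let S : Setoid A := ⟨R, hR.1⟩
  let str : L.Structure (Quotient S) :=
    { funMap := fun F x =>
        Quotient.mk S (FirstOrder.Language.Structure.funMap F fun i => (x i).out)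
      RelMap := fun r => isEmptyElim r }
  let π : A →[L] Quotient S :=
    { toFun := Quotient.mk S
      map_fun' := fun F x => Quotient.sound <| hR.2 F _ _ fun i =>
        hR.1.symm (Quotient.mk_out (s := S) (x i))
      map_rel' := fun r => isEmptyElim r }
  -- Lifting variables to representatives reduces each identity in the quotient to `A`.
  have hπ (s : L.Term ℕ) (x : ℕ → Quotient S) :
      s.realize x = π (s.realize fun i => (x i).out) := by
    rw [← FirstOrder.Language.HomClass.realize_term]
    congr 1
    exact funext fun i => (Quotient.out_eq (x i)).symm
  let Q : VarietyAlg.{u, v, w} L E :=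
    { carrier := Quotient S
      str := str
      sat := fun s hs x => by rw [hπ, hπ, A.sat s hs] }
  exact ⟨Q, π, Quotient.mk_surjective, fun a a' => Quotient.eq (r := S)⟩

theorem isCongruence_ker {M N : Type*} [L.Structure M] [L.Structure N] (f : M →[L] N) :
    IsCongruence L fun x y => f x = f y := by
  refine ⟨⟨fun _ => rfl, Eq.symm, Eq.trans⟩, fun n F x y h => ?_⟩
  simp only [FirstOrder.Language.Hom.map_fun]
  congr 1
  exact funext h

/-- A surjective homomorphism on a product is a product of surjective homomorphisms. -/
theorem exists_product_diagram [L.IsAlgebraic] (hdiag : HasDiagonalisingTerm.{u, v, w} L E)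
    {X Y Z : VarietyAlg.{u, v, w} L E} (h : X ⨯ Y ⟶ Z) (hh : Function.Surjective h) :
    ∃ (A B : VarietyAlg.{u, v, w} L E) (f : X ⟶ A) (g : Y ⟶ B) (p : Z ⟶ A) (q : Z ⟶ B),
      prod.fst ≫ f = h ≫ p ∧ prod.snd ≫ g = h ≫ q ∧
        Nonempty (IsLimit (BinaryFan.mk p q)) := by
  -- `r` carries the kernel of `h` to the concrete product of pairs, where the splitting of
  -- relations applies.
  obtain ⟨r, hr₁, hr₂⟩ := BinaryFan.IsLimit.lift' (prodIsProd X Y) (prodFst X Y) (prodSnd X Y)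
  have hr (z : (X ⨯ Y : VarietyAlg.{u, v, w} L E)) :
      r ((prod.fst : X ⨯ Y ⟶ X) z, (prod.snd : X ⨯ Y ⟶ Y) z) = z :=
    (bijective_prod X Y).1 (Prod.ext (ConcreteCategory.congr_hom hr₁ _)
      (ConcreteCategory.congr_hom hr₂ _))
  let R : X × Y → X × Y → Prop := fun x y => h (r x) = h (r y)
  have hR : IsCongruence L R :=
    isCongruence_ker (M := prod X Y) (N := Z) (r ≫ h : VarietyAlg.prod X Y ⟶ Z)
  have hprod := eq_prodRel hdiag hR.isReflexiveHomomorphicRel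
  obtain ⟨A, f, hf, hfR⟩ := exists_quotient X (isCongruence_relFst hdiag hR)
  obtain ⟨B, g, hg, hgR⟩ := exists_quotient Y (isCongruence_relSnd hdiag hR)
  have hker (z z' : (X ⨯ Y : VarietyAlg.{u, v, w} L E)) :
      h z = h z' ↔ f ((prod.fst : X ⨯ Y ⟶ X) z) = f ((prod.fst : X ⨯ Y ⟶ X) z') ∧
        g ((prod.snd : X ⨯ Y ⟶ Y) z) = g ((prod.snd : X ⨯ Y ⟶ Y) z') := by
    rw [hfR, hgR]
    conv_lhs => rw [← hr z, ← hr z']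
    exact iff_of_eq (congrFun (congrFun hprod _) _)
  obtain ⟨p, hp⟩ := exists_desc h hh (prod.fst ≫ f) fun z z' hz => ((hker z z').1 hz).1
  obtain ⟨q, hq⟩ := exists_desc h hh (prod.snd ≫ g) fun z z' hz => ((hker z z').1 hz).2
  have hp' := ConcreteCategory.congr_hom hp
  have hq' := ConcreteCategory.congr_hom hq
  refine ⟨A, B, f, g, p, q, hp.symm, hq.symm, (nonempty_isLimit_iff_bijective p q).2 ⟨?_, ?_⟩⟩
  · intro z z' hz
    obtain ⟨z, rfl⟩ := hh z
    obtain ⟨z', rfl⟩ := hh z'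
    exact (hker z z').2 ⟨(hp' z).symm.trans ((congrArg Prod.fst hz).trans (hp' z')),
      (hq' z).symm.trans ((congrArg Prod.snd hz).trans (hq' z'))⟩
  · rintro ⟨a, b⟩
    obtain ⟨x, rfl⟩ := hf a
    obtain ⟨y, rfl⟩ := hg b
    obtain ⟨z, rfl, rfl⟩ := exists_prod_eq x y
    exact ⟨h z, Prod.ext (hp' z) (hq' z)⟩

theorem coextensivityConditionFor_of_surjective [L.IsAlgebraic]
    (hdiag : HasDiagonalisingTerm.{u, v, w} L E) {X Y Z : VarietyAlg.{u, v, w} L E}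
    (h : X ⨯ Y ⟶ Z) (hh : Function.Surjective h) : CoextensivityConditionFor h := by
  intro A B f g p q hf hg
  refine ⟨leftCoextensive hdiag h f g p q hf hg, fun ⟨hA, hB⟩ => ?_⟩
  obtain ⟨A', B', f', g', p', q', hf', hg', hl⟩ := exists_product_diagram hdiag h hh
  obtain ⟨hA', hB'⟩ := leftCoextensive hdiag h f' g' p' q' hf' hg' hl
  -- Both rows are pushouts of the same spans, so the given row is isomorphic to a product row.
  let i := hA'.isoIsPushout _ _ hA
  let j := hB'.isoIsPushout _ _ hB
  have hi (z : Z) : i.hom (p' z) = p z :=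
    ConcreteCategory.congr_hom (hA'.inr_isoIsPushout_hom _ _ hA) z
  have hj (z : Z) : j.hom (q' z) = q z :=
    ConcreteCategory.congr_hom (hB'.inr_isoIsPushout_hom _ _ hB) z
  have hib : Function.Bijective i.hom := Function.bijective_iff_has_inverse.2
    ⟨i.inv, ConcreteCategory.congr_hom i.hom_inv_id, ConcreteCategory.congr_hom i.inv_hom_id⟩
  have hjb : Function.Bijective j.hom := Function.bijective_iff_has_inverse.2
    ⟨j.inv, ConcreteCategory.congr_hom j.hom_inv_id, ConcreteCategory.congr_hom j.inv_hom_id⟩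
  rw [nonempty_isLimit_iff_bijective] at hl ⊢
  have := (hib.prodMap hjb).comp hl
  convert this using 1
  exact funext fun z => Prod.ext (hi z).symm (hj z).symm

end VarietyAlg

theorem proposition3p3 (L : FirstOrder.Language.{u, v}) [L.IsAlgebraic] (E : Identities L)
    (hdiag : HasDiagonalisingTerm.{u, v, w} L E) :
    HasCodisjointProducts (VarietyAlg.{u, v, w} L E) ∧
    LeftCoextensive (VarietyAlg.{u, v, w} L E) ∧
    (∀ (A B : VarietyAlg.{u, v, w} L E) (R : A × B → A × B → Prop),
      IsReflexiveHomomorphicRel L R →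
        ∃ (RA : A → A → Prop) (RB : B → B → Prop),
          IsReflexiveHomomorphicRel L RA ∧ IsReflexiveHomomorphicRel L RB ∧ R = prodRel RA RB) ∧
    (∀ (A B : VarietyAlg.{u, v, w} L E) (R : A × B → A × B → Prop),
      IsCongruence L R →
        ∃ (RA : A → A → Prop) (RB : B → B → Prop),
          IsCongruence L RA ∧ IsCongruence L RB ∧ R = prodRel RA RB) ∧
    (∀ (A B Z : VarietyAlg.{u, v, w} L E) (q : A ⨯ B ⟶ Z),
      Function.Surjective q → CoextensivityConditionFor q) := by
  exact ⟨VarietyAlg.hasCodisjointProducts hdiag, VarietyAlg.leftCoextensive hdiag,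
    fun _ _ R hR => ⟨_, _, VarietyAlg.isReflexiveHomomorphicRel_relFst hdiag hR,
      VarietyAlg.isReflexiveHomomorphicRel_relSnd hdiag hR, VarietyAlg.eq_prodRel hdiag hR⟩,
    fun _ _ R hR => ⟨_, _, VarietyAlg.isCongruence_relFst hdiag hR,
      VarietyAlg.isCongruence_relSnd hdiag hR,
      VarietyAlg.eq_prodRel hdiag hR.isReflexiveHomomorphicRel⟩,
    fun _ _ _ q hq => VarietyAlg.coextensivityConditionFor_of_surjective hdiag q hq⟩
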